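/- **Setting.** Let $V$ be a countable set and let $\hat\Sigma$ be a simplicial complex on $V$, i.e. a family of finite subsets of $V$ with $\tau\in\hat\Sigma$ whenever $\tau\subseteq\sigma\in\hat\Sigma$ (so $\varnothing\in\hat\Sigma$ if $\hat\Sigma$ is non-empty). Let $m:\hat\Sigma\to(0,\infty)$ be a weight. Put $\Sigma=\hat\Sigma$ if $\sum_{v} m(\{v\})<\infty$ (sum over all one-element simplices) and $\Sigma=\hat\Sigma\setminus\{\varnothing\}$ otherwise. For $\tau,\sigma\in\Sigma$ write $\tau\prec\sigma$ (or $\sigma\succ\tau$) if $\tau\subset\sigma$ and $|\sigma\setminus\tau|=1$. Assume that $m$ is locally summable: $\sum_{\sigma\succ\tau}m(\sigma)<\infty$ for all $\tau\in\Sigma$. Let $F=\mathbb R^{\Sigma}$, let $F^c\subseteq F$ be the space of finitely supported functions, and let $F^1=\{\omega\in F:\sum_{\sigma\succ\tau}m(\sigma)|\omega(\sigma)|<\infty\text{ for all }\tau\in\Sigma\}$. Let $\delta:F\to F$ be a coboundary operator: a linear map with $\delta\delta=0$ such that $\theta(\tau,\sigma):=\delta 1_\tau(\sigma)\in\{-1,0,1\}$,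 $\theta(\tau,\sigma)\neq0$ if and only if $\tau\prec\sigma$, and $\delta\omega(\sigma)=\sum_{\tau\prec\sigma}\omega(\tau)\theta(\tau,\sigma)$. The boundary operator is $$\partial:F^1\to F,\qquad \partial\omega(\rho)=\frac1{m(\rho)}\sum_{\tau\succ\rho}m(\tau)\,\omega(\tau)\,\theta(\rho,\tau).$$ Let $\ell^2=\ell^2(\Sigma,m)$ be the real Hilbert space of all $\omega\in F$ with $\sum_\Sigma m\,\omega^2<\infty$, with inner product $\langle\omega,\eta\rangle=\sum_\Sigma m\,\omega\eta$. Put $$d^+=\delta,\quad d^-=\partial,\quad d^H=\delta+\partial,\qquad \mathcal L^+=\partial\delta,\quad \mathcal L^-=\delta\partial,\quad \mathcal L^H=(\delta+\partial)^2,$$ sums and compositions being taken on their maximal domains in $F$. For $\bullet\in\{+,-,H\}$ let $Q^\bullet_N(\omega)=\|d^\bullet\omega\|^2$ on the space of those $\omega\in\ell^2$ in the domain of $d^\bullet$ for which $d^\bullet\omega\in\ell^2$, and let $Q^\bullet_D$ be the restriction of $Q^\bullet_N$ to the closure of $F^c$ in the form norm $(Q^\bullet_N(\cdot)+\|\cdot\|^2)^{1/2}$.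 A Laplacian $\Delta^\bullet$ (up-Laplacian for $+$, down-Laplacian for $-$, Hodge Laplacian for $H$) is the positive self-adjoint operator in $\ell^2$ associated with some closed quadratic form $Q^\bullet$ with $Q^\bullet_D\subseteq Q^\bullet\subseteq Q^\bullet_N$. Let $\Delta^\bullet_c=\mathcal L^\bullet|_{F^c}$. The Forman curvature is $c^H/m$, where, with all sums over elements of $\Sigma$, $$c^H(\tau)=\sum_{\rho\prec\tau}\frac{m(\tau)^2}{m(\rho)}+\sum_{\sigma\succ\tau}m(\sigma)-\sum_{\rho\prec\tau}\ \sum_{\tau'\succ\rho,\ \tau'\ne\tau}\Big|\frac{m(\tau)m(\tau')}{m(\rho)}-\sum_{\sigma\succ\tau,\ \sigma\succ\tau'}m(\sigma)\Big| .$$ **Theorem.** Suppose that $m$ is uniformly positive, i.e. $\inf_{\sigma\in\Sigma}m(\sigma)>0$, and that the Forman curvature $c^H/m$ is bounded from below on $\Sigma$. Then for each $\bullet\in\{+,-,H\}$ the operator $\mathcal L^\bullet$ is defined on $F^c$ and maps $F^c$ into $\ell^2$; every Laplacian $\Delta^\bullet$ has $F^c$ in its domain and its restriction to $F^c$ is $\Delta^\bullet_c$;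 and $\Delta^\bullet_c$, as an operator in $\ell^2$ with domain $F^c$, is essentially self-adjoint (densely defined and closable with self-adjoint closure). -/

import Mathlib

noncomputable section

open scoped InnerProductSpace

/-- A simplicial complex `Σ̂` on the vertex set `V` (a family of finite subsets of `V` closed under
passing to subsets, the empty set included) with a strictly positive weight `m` on `Σ̂`. -/
structure WeightedComplex (V : Type*) where
  simplices : Set (Finset V)
  down_closed : ∀ σ ∈ simplices, ∀ τ ⊆ σ, τ ∈ simplices
  weight : simplices → ℝ
  weight_pos : ∀ σ, 0 < weight σ

namespace WeightedComplex

variable {V : Type*} (K : WeightedComplex V)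

/-- The index set `Σ`: it is `Σ̂` if the vertices have finite total weight, and `Σ̂` without the
empty simplex otherwise. -/
def carrier : Set (Finset V) :=
  {σ | σ ∈ K.simplices ∧
    (σ.Nonempty ∨ Summable fun v : {v : K.simplices // v.1.card = 1} => K.weight v.1)}

abbrev Simplex : Type _ := {σ : Finset V // σ ∈ K.carrier}

/-- The weight on `Σ`. -/
def m (σ : K.Simplex) : ℝ := K.weight ⟨σ.1, σ.2.1⟩

theorem m_pos (σ : K.Simplex) : 0 < K.m σ := K.weight_pos _

variable {K} in
/-- `IsFace τ σ` is `τ ≺ σ`: `τ ⊆ σ` and `σ` has exactly one vertex more than `τ`. -/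
def IsFace (τ σ : K.Simplex) : Prop := τ.1 ⊆ σ.1 ∧ σ.1.card = τ.1.card + 1

/-- The faces of `σ` (elements of `Σ`). -/
abbrev Faces (σ : K.Simplex) : Type _ := {τ : K.Simplex // IsFace τ σ}

/-- The cofaces of `τ`. -/
abbrev Cofaces (τ : K.Simplex) : Type _ := {σ : K.Simplex // IsFace τ σ}

theorem finite_faces (σ : K.Simplex) : Finite (K.Faces σ) :=
  Finite.of_injective
    (fun τ : K.Faces σ => (⟨τ.1.1, Finset.mem_powerset.2 τ.2.1⟩ : {t // t ∈ σ.1.powerset}))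
    (fun _ _ h => Subtype.ext (Subtype.ext (congrArg (fun x => x.1) h)))

/-- Local summability of the weight. -/
def LocallySummable : Prop :=
  ∀ τ : K.Simplex, Summable fun σ : K.Cofaces τ => K.m σ.1

/-- The weight is bounded away from zero. -/
def UniformlyPositive : Prop :=
  ∃ c : ℝ, 0 < c ∧ ∀ σ : K.Simplex, c ≤ K.m σ

/-- The space `F` of all real functions on `Σ`. -/
abbrev Fun : Type _ := K.Simplex → ℝ

/-- The function `1_τ`. -/
def char (τ : K.Simplex) : K.Fun := Set.indicator {τ} fun _ => (1 : ℝ)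

/-- A coboundary operator `δ : F → F`. -/
structure Coboundary where
  toLinearMap : K.Fun →ₗ[ℝ] K.Fun
  sign_values : ∀ τ σ, toLinearMap (K.char τ) σ ∈ ({-1, 0, 1} : Set ℝ)
  sign_ne_zero_iff : ∀ τ σ, toLinearMap (K.char τ) σ ≠ 0 ↔ IsFace τ σ
  apply_eq : ∀ (ω : K.Fun) (σ : K.Simplex),
    toLinearMap ω σ = ∑ᶠ τ : K.Faces σ, ω τ.1 * toLinearMap (K.char τ.1) σ
  comp_self : toLinearMap ∘ₗ toLinearMap = 0

variable {K} in
/-- The incidence sign `θ(τ, σ) = δ 1_τ (σ)`. -/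
def Coboundary.sign (δ : K.Coboundary) (τ σ : K.Simplex) : ℝ := δ.toLinearMap (K.char τ) σ

variable {K} in
theorem Coboundary.abs_sign_le (δ : K.Coboundary) (τ σ : K.Simplex) : |δ.sign τ σ| ≤ 1 := by
  have h := δ.sign_values τ σ
  change δ.sign τ σ ∈ ({-1, 0, 1} : Set ℝ) at h
  rcases h with h | h | h <;> rw [h] <;> simp

/-- The space `F¹` of functions `ω` with `∑_{σ ≻ τ} m(σ) |ω(σ)| < ∞` for all `τ`. -/
def F1 : Submodule ℝ K.Fun where
  carrier := {ω | ∀ τ : K.Simplex, Summable fun σ : K.Cofaces τ => K.m σ.1 * |ω σ.1|}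
  zero_mem' := by intro τ; simp
  add_mem' := by
    intro _ _ ha hb τ
    refine Summable.of_nonneg_of_le (fun σ => mul_nonneg (K.m_pos _).le (abs_nonneg _))
      (fun σ => ?_) ((ha τ).add (hb τ))
    rw [← mul_add]
    exact mul_le_mul_of_nonneg_left (abs_add_le _ _) (K.m_pos _).le
  smul_mem' := by
    intro c a ha τ
    refine ((ha τ).mul_left |c|).congr fun σ => ?_
    simp only [Pi.smul_apply, smul_eq_mul, abs_mul]
    ring

/-- The space `F^c` of finitely supported functions. -/
def Fc : Submodule ℝ K.Fun where
  carrier := {ω | (Function.support ω).Finite}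
  zero_mem' := by simp
  add_mem' := fun ha hb => (ha.union hb).subset (Function.support_add _ _)
  smul_mem' := fun c a ha => Set.Finite.subset ha (Function.support_const_smul_subset c a)

variable {K}

theorem Coboundary.summable_boundary (δ : K.Coboundary) {ω : K.Fun} (hω : ω ∈ K.F1)
    (ρ : K.Simplex) :
    Summable fun τ : K.Cofaces ρ => K.m τ.1 * ω τ.1 * δ.sign ρ τ.1 := by
  refine Summable.of_norm_bounded (hω ρ) fun τ => ?_
  rw [Real.norm_eq_abs, abs_mul, abs_mul, abs_of_pos (K.m_pos _)]
  exact mul_le_of_le_one_right (mul_nonneg (K.m_pos _).le (abs_nonneg _)) (δ.abs_sign_le _ _)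

/-- The boundary operator `∂ω(ρ) = m(ρ)⁻¹ ∑_{τ ≻ ρ} m(τ) ω(τ) θ(ρ, τ)` with domain `F¹`. -/
def Coboundary.boundary (δ : K.Coboundary) : K.Fun →ₗ.[ℝ] K.Fun where
  domain := K.F1
  toFun :=
    { toFun := fun ω ρ =>
        (K.m ρ)⁻¹ * ∑' τ : K.Cofaces ρ, K.m τ.1 * ω.1 τ.1 * δ.sign ρ τ.1
      map_add' := by
        intro a b
        funext ρ
        simp only [Pi.add_apply]
        rw [← mul_add, ← (δ.summable_boundary a.2 ρ).tsum_add (δ.summable_boundary b.2 ρ)]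
        congr 1
        refine tsum_congr fun τ => ?_
        simp only [Submodule.coe_add, Pi.add_apply]
        ring
      map_smul' := by
        intro c a
        funext ρ
        simp only [RingHom.id_apply, Pi.smul_apply, smul_eq_mul]
        rw [mul_left_comm, ← tsum_mul_left (a := c)]
        congr 1
        refine tsum_congr fun τ => ?_
        simp only [SetLike.val_smul, Pi.smul_apply, smul_eq_mul]
        ring }

/-- `δ` as an operator with domain `F`. -/
def Coboundary.coboundary (δ : K.Coboundary) : K.Fun →ₗ.[ℝ] K.Fun :=
  δ.toLinearMap.toPMap ⊤

/-- The composition `B A` of two operators, with its maximal domain `{ω ∈ D(A) | A ω ∈ D(B)}`. -/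
def pcomp {E : Type*} [AddCommGroup E] [Module ℝ E] (B A : E →ₗ.[ℝ] E) : E →ₗ.[ℝ] E :=
  B.comp (A.domRestrict ((B.domain.comap A.toFun).map A.domain.subtype)) (by
    rintro ⟨x, ⟨⟨y, hy, rfl⟩, hx⟩⟩
    exact hy)

/-- The three types of Laplacians: `Δ⁺`, `Δ⁻`, `Δᴴ`. -/
inductive Kind
  | up
  | down
  | hodge

/-- The first order operators `δ`, `∂`, `δ + ∂`, each with its maximal domain in `F`. The quadratic
form `𝒬^•` is the square of the `ℓ²`-norm of `firstOrder δ •`. -/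
def Coboundary.firstOrder (δ : K.Coboundary) : Kind → (K.Fun →ₗ.[ℝ] K.Fun)
  | .up => δ.coboundary
  | .down => δ.boundary
  | .hodge => δ.coboundary + δ.boundary

/-- The formal Laplacians `∂ δ`, `δ ∂` and `(δ + ∂)²`, each with its maximal domain in `F`. -/
def Coboundary.formalLaplacian (δ : K.Coboundary) : Kind → (K.Fun →ₗ.[ℝ] K.Fun)
  | .up => pcomp δ.boundary δ.coboundary
  | .down => pcomp δ.coboundary δ.boundary
  | .hodge => pcomp (δ.coboundary + δ.boundary) (δ.coboundary + δ.boundary)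

variable (K)

/-- A copy of `ℝ` that carries the inner product `⟪x, y⟫ = m(σ) x y`. -/
def Fibre (_ : K.Simplex) : Type := ℝ

instance (σ : K.Simplex) : AddCommGroup (K.Fibre σ) := inferInstanceAs (AddCommGroup ℝ)

instance (σ : K.Simplex) : Module ℝ (K.Fibre σ) := inferInstanceAs (Module ℝ ℝ)

instance (σ : K.Simplex) : FiniteDimensional ℝ (K.Fibre σ) :=
  inferInstanceAs (FiniteDimensional ℝ ℝ)

variable {K} in
/-- The real number underlying an element of a fibre. -/
def Fibre.val {σ : K.Simplex} : K.Fibre σ ≃ₗ[ℝ] ℝ := LinearEquiv.refl ℝ ℝ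

/-- The inner product `⟪x, y⟫ = m(σ) x y`. -/
@[reducible] def fibreCore (σ : K.Simplex) : InnerProductSpace.Core ℝ (K.Fibre σ) where
  inner x y := K.m σ * x.val * y.val
  conj_inner_symm x y := by
    simp only [conj_trivial]
    ring
  re_inner_nonneg x := by
    simp only [RCLike.re_to_real, mul_assoc]
    exact mul_nonneg (K.m_pos σ).le (mul_self_nonneg _)
  add_left x y z := by
    simp only [map_add]
    ring
  smul_left x y r := by
    simp only [map_smul, conj_trivial, smul_eq_mul]
    ring
  definite x h := by
    rw [mul_assoc] at h
    exact mul_self_eq_zero.1 ((mul_eq_zero.1 h).resolve_left (K.m_pos σ).ne')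

instance (σ : K.Simplex) : NormedAddCommGroup (K.Fibre σ) := (K.fibreCore σ).toNormedAddCommGroup

instance (σ : K.Simplex) : InnerProductSpace ℝ (K.Fibre σ) :=
  InnerProductSpace.ofCore (K.fibreCore σ).toCore

instance (σ : K.Simplex) : CompleteSpace (K.Fibre σ) := FiniteDimensional.complete ℝ _

/-- The real Hilbert space `ℓ²(Σ, m)` of functions with `∑ m ω² < ∞` and with inner product
`∑ m ω η`. -/
abbrev L2 : Type _ := lp K.Fibre 2

/-- The inclusion `ℓ²(Σ, m) ⊆ F`. -/
def L2.toFun : K.L2 →ₗ[ℝ] K.Fun where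
  toFun f σ := (f σ).val
  map_add' f g := by funext σ; simp
  map_smul' c f := by funext σ; simp

theorem L2.toFun_injective : Function.Injective (L2.toFun K) := fun _ _ h =>
  lp.ext (funext fun σ => Fibre.val.injective (congrFun h σ))

theorem L2.inner_eq (f g : K.L2) :
    ⟪f, g⟫_ℝ = ∑' σ, K.m σ * L2.toFun K f σ * L2.toFun K g σ :=
  lp.inner_eq_tsum f g

/-- Every square summable function is in the image of `L2.toFun`, and conversely. -/
theorem L2.exists_iff (ω : K.Fun) :
    (∃ f : K.L2, L2.toFun K f = ω) ↔ Summable fun σ => K.m σ * ω σ ^ 2 := by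
  have key : ∀ (σ : K.Simplex) (x : K.Fibre σ), ‖x‖ ^ 2 = K.m σ * x.val ^ 2 := by
    intro σ x
    rw [← real_inner_self_eq_norm_sq]
    change K.m σ * x.val * x.val = _
    ring
  constructor
  · rintro ⟨f, rfl⟩
    have h := (memℓp_gen_iff (p := 2) (by norm_num)).1 (lp.memℓp f)
    refine h.congr fun σ => ?_
    simp only [ENNReal.toReal_ofNat, Real.rpow_ofNat]
    exact key σ (f σ)
  · intro h
    have hm : Memℓp (fun σ => (Fibre.val (K := K) (σ := σ)).symm (ω σ)) 2 := by
      refine (memℓp_gen_iff (p := 2) (by norm_num)).2 (h.congr fun σ => ?_)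
      simp only [ENNReal.toReal_ofNat, Real.rpow_ofNat]
      rw [key, LinearEquiv.apply_symm_apply]
    exact ⟨⟨_, hm⟩, funext fun σ =>
      (Fibre.val (K := K) (σ := σ)).apply_symm_apply (ω σ)⟩

/-- The finitely supported functions as a subspace of `ℓ²(Σ, m)`. -/
def FcL2 : Submodule ℝ K.L2 := K.Fc.comap (L2.toFun K)

/-- The part of an operator `A` on `F` in `ℓ²(Σ, m)`: its graph consists of all pairs `(f, g)` in
`ℓ² × ℓ²` with `f ∈ D(A)` and `A f = g`. -/
def partL2 (A : K.Fun →ₗ.[ℝ] K.Fun) : K.L2 →ₗ.[ℝ] K.L2 :=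
  (A.graph.comap ((L2.toFun K).prodMap (L2.toFun K))).toLinearPMap

theorem partL2_graph (A : K.Fun →ₗ.[ℝ] K.Fun) :
    (K.partL2 A).graph = A.graph.comap ((L2.toFun K).prodMap (L2.toFun K)) := by
  refine Submodule.toLinearPMap_graph_eq _ ?_
  rintro ⟨f, g⟩ h h0
  simp only at h0
  subst h0
  apply L2.toFun_injective K
  rw [map_zero]
  exact A.graph_fst_eq_zero_snd h (map_zero (L2.toFun K))

variable {K}

/-- `δ`, `∂`, `δ + ∂` with domain `D(Q^•_N) = {ω ∈ ℓ² | 𝒬^•(ω) < ∞}`, as an operator in `ℓ²`. Thus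
`Q^•_N(ω, η) = ⟪T ω, T η⟫` for `T = neumannOp δ •`, and the form norm of `Q^•_N` is the graph norm
of `T`. -/
def Coboundary.neumannOp (δ : K.Coboundary) (k : Kind) : K.L2 →ₗ.[ℝ] K.L2 :=
  K.partL2 (δ.firstOrder k)

/-- The restriction to `D(Q^•_D)`, the closure of `F^c` in `D(Q^•_N)` in the form norm. -/
def Coboundary.dirichletOp (δ : K.Coboundary) (k : Kind) : K.L2 →ₗ.[ℝ] K.L2 :=
  ((δ.neumannOp k).domRestrict K.FcL2).closure

/-- `A` is a Laplacian `Δ^•`: the positive self-adjoint operator associated with a closed quadratic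
form `Q` such that `Q^•_D ⊆ Q ⊆ Q^•_N`. Such a form is `Q(ω) = ‖T ω‖²`, `D(Q) = D(T)`, for a
restriction `T` of `neumannOp δ •`, and it is closed if and only if `T` is. -/
def Coboundary.IsLaplacian (δ : K.Coboundary) (k : Kind) (A : K.L2 →ₗ.[ℝ] K.L2) : Prop :=
  ∃ T : K.L2 →ₗ.[ℝ] K.L2,
    δ.dirichletOp k ≤ T ∧ T ≤ δ.neumannOp k ∧ T.IsClosed ∧
    IsSelfAdjoint A ∧ (∀ η : A.domain, 0 ≤ ⟪(η : K.L2), A η⟫_ℝ) ∧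
    A.domain ≤ T.domain ∧
    ∀ (ω : T.domain) (η : A.domain) (η' : T.domain), (η' : K.L2) = η →
      ⟪T ω, T η'⟫_ℝ = ⟪(ω : K.L2), A η⟫_ℝ

/-- The operator `Δ^•_c` in `ℓ²(Σ, m)`: the restriction of the formal Laplacian to `F^c` (to those
elements of `F^c` that it maps into `ℓ²`). -/
def Coboundary.laplacianC (δ : K.Coboundary) (k : Kind) : K.L2 →ₗ.[ℝ] K.L2 :=
  (K.partL2 (δ.formalLaplacian k)).domRestrict K.FcL2

variable (K) in
/-- The function `c^H`. The sums run over elements of `Σ`. -/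
def curvatureH (τ : K.Simplex) : ℝ :=
  ∑ᶠ ρ : K.Faces τ, K.m τ ^ 2 / K.m ρ.1
    + ∑' σ : K.Cofaces τ, K.m σ.1
    - ∑ᶠ ρ : K.Faces τ, ∑' τ' : {τ' : K.Simplex // IsFace ρ.1 τ' ∧ τ' ≠ τ},
        |K.m τ * K.m τ'.1 / K.m ρ.1
          - ∑' σ : {σ : K.Simplex // IsFace τ σ ∧ IsFace τ'.1 σ}, K.m σ.1|

variable (K) in
/-- The Forman curvature `c^H / m`. -/
def formanCurvature (τ : K.Simplex) : ℝ := K.curvatureH τ / K.m τ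

end WeightedComplex

/-- A densely defined operator is essentially self-adjoint if it is closable and its closure is
self-adjoint. -/
def IsEssentiallySelfAdjoint {H : Type*} [NormedAddCommGroup H] [InnerProductSpace ℝ H]
    [CompleteSpace H] (A : H →ₗ.[ℝ] H) : Prop :=
  Dense (A.domain : Set H) ∧ A.IsClosable ∧ IsSelfAdjoint A.closure

end

noncomputable section

open scoped InnerProductSpace

/-! Uniform positivity turns local summability into local finiteness, so `∂` and the formal
Laplacians act on all functions and preserve `F^c`. With respect to `∑ m ω η`, where `ω` has finite
support, `δ` and `∂` are adjoint. Hence `Δ_c` is symmetric and nonnegative, and Green's formula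
makes it a formal adjoint of every Laplacian `A`; so `Δ_c ≤ A* = A`.

For essential self-adjointness it suffices that `Δ_c + c` has dense range for some `c > 0`
(`isEssentiallySelfAdjoint_of_range_dense`). A vector `u` orthogonal to the range satisfies `ℒu =
-cu` pointwise. Because `δδ = 0` and `∂∂ = 0`, such a `u` is also an eigenfunction of the Hodge
Laplacian (`laplacianLM_hodge_of_eigen`), so one case remains.

That case is a maximum principle. Since `u ∈ ℓ²` and `m` is bounded below, `|u|` attains its
maximum, say at `τ` with `u τ > 0`. The off-diagonal coefficients of `m ℒᴴ` at `τ` are, up to sign,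
the differences inside the absolute values in `c^H`: the path from `τ` to `τ'` through a common face
and the paths through common cofaces carry opposite signs (`sign_mul_sign_coface`). So `c^H` is the
diagonal minus the absolute off-diagonal sum, and `m ℒᴴu ≥ c^H u` at `τ` (`curvatureH_mul_le`;
simplices without a face in `Σ` need separate care). A large `c` contradicts this. -/

/-! ### An abstract criterion for essential self-adjointness -/

theorem LinearPMap.IsClosable.closure_le {H : Type*} [NormedAddCommGroup H]
    [InnerProductSpace ℝ H] {S T : H →ₗ.[ℝ] H} (hST : S ≤ T) (hT : T.IsClosed) :
    S.closure ≤ T := by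
  have hS : S.IsClosable := hT.isClosable.leIsClosable hST
  rw [← LinearPMap.le_graph_iff, ← hS.graph_closure_eq_closure_graph]
  exact Submodule.topologicalClosure_minimal _ (LinearPMap.le_graph_of_le hST) hT

/-- A symmetric nonnegative densely defined operator `S` is essentially self-adjoint if the
orthogonal complement of the range of `S + c` is trivial for some `c > 0`. -/
theorem isEssentiallySelfAdjoint_of_range_dense {H : Type*} [NormedAddCommGroup H]
    [InnerProductSpace ℝ H] [CompleteSpace H] {S : H →ₗ.[ℝ] H}
    (hdense : Dense (S.domain : Set H)) (hsymm : S.IsFormalAdjoint S)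
    (hnonneg : ∀ x : S.domain, 0 ≤ ⟪S x, (x : H)⟫_ℝ) {c : ℝ} (hc : 0 < c)
    (hker : ∀ u : H, (∀ x : S.domain, ⟪S x + c • (x : H), u⟫_ℝ = 0) → u = 0) :
    IsEssentiallySelfAdjoint S := by
  have hle : S ≤ S.adjoint := hsymm.le_adjoint hdense
  have hclosedT : S.adjoint.IsClosed := LinearPMap.adjoint_isClosed hdense
  have hclosable : S.IsClosable := hclosedT.isClosable.leIsClosable hle
  have hBT : S.closure ≤ S.adjoint := LinearPMap.IsClosable.closure_le hle hclosedT
  have hdenseB : Dense (S.closure.domain : Set H) := hdense.mono S.le_closure.1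
  have hgraph : (S.closure.graph : Set (H × H)) = closure (S.graph : Set (H × H)) := by
    rw [← hclosable.graph_closure_eq_closure_graph, Submodule.topologicalClosure_coe]
  have hformal : S.adjoint.IsFormalAdjoint S.closure := by
    intro x y
    have hsub : (S.closure.graph : Set (H × H)) ⊆
        {p : H × H | ⟪S.adjoint x, p.1⟫_ℝ = ⟪(x : H), p.2⟫_ℝ} := by
      rw [hgraph]
      refine closure_minimal ?_ (isClosed_eq (by fun_prop) (by fun_prop))
      intro p hp
      obtain ⟨z, hz1, hz2⟩ := (LinearPMap.mem_graph_iff S).1 hp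
      simp only [Set.mem_ofPred_eq, ← hz1, ← hz2]
      exact LinearPMap.adjoint_isFormalAdjoint hdense x z
    exact hsub (S.closure.mem_graph y)
  have hnonnegB : ∀ p ∈ S.closure.graph, 0 ≤ ⟪p.2, p.1⟫_ℝ := by
    have hsub : (S.closure.graph : Set (H × H)) ⊆ {p : H × H | 0 ≤ ⟪p.2, p.1⟫_ℝ} := by
      rw [hgraph]
      refine closure_minimal ?_ (isClosed_le (by fun_prop) (by fun_prop))
      intro p hp
      obtain ⟨z, hz1, hz2⟩ := (LinearPMap.mem_graph_iff S).1 hp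
      simp only [Set.mem_ofPred_eq, ← hz1, ← hz2]
      exact hnonneg z
    exact hsub
  -- On its graph, `S.closure + c` is a bounded operator; a lower bound for it will make the range
  -- closed.
  let R : S.closure.graph →L[ℝ] H :=
    (ContinuousLinearMap.snd ℝ H H + c • ContinuousLinearMap.fst ℝ H H).comp
      S.closure.graph.subtypeL
  have hR : ∀ p : S.closure.graph, R p = p.1.2 + c • p.1.1 := fun p => rfl
  have hbound : ∀ p : S.closure.graph, ‖p‖ ≤ (1 + c⁻¹) * ‖R p‖ := by
    intro p
    have h0 := hnonnegB p.1 p.2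
    -- Nonnegativity of the cross term lets `‖R p‖` control both components.
    have hsq : ‖R p‖ ^ 2 = ‖p.1.2‖ ^ 2 + 2 * (c * ⟪p.1.2, p.1.1⟫_ℝ) + (c * ‖p.1.1‖) ^ 2 := by
      rw [hR, norm_add_sq_real, real_inner_smul_right, norm_smul, Real.norm_eq_abs,
        abs_of_pos hc]
    have hc0 : 0 ≤ c * ⟪p.1.2, p.1.1⟫_ℝ := mul_nonneg hc.le h0
    have h2 : ‖p.1.2‖ ≤ ‖R p‖ :=
      le_of_sq_le_sq (by nlinarith [sq_nonneg (c * ‖p.1.1‖)]) (norm_nonneg _)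
    have h1 : c * ‖p.1.1‖ ≤ ‖R p‖ :=
      le_of_sq_le_sq (by nlinarith [sq_nonneg ‖p.1.2‖]) (norm_nonneg _)
    have h1' : ‖p.1.1‖ ≤ c⁻¹ * ‖R p‖ := by
      rw [inv_mul_eq_div, le_div_iff₀ hc, mul_comm]
      exact h1
    have hci : 0 ≤ c⁻¹ * ‖R p‖ := by positivity
    change max ‖p.1.1‖ ‖p.1.2‖ ≤ _
    rw [add_mul, one_mul]
    exact max_le (by linarith [norm_nonneg (R p)]) (by linarith)
  have hcomplete : CompleteSpace S.closure.graph :=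
    hclosable.closure_isClosed.completeSpace_coe
  have hclosedR : IsClosed (Set.range R) :=
    (R.antilipschitz_of_bound (K := ⟨1 + c⁻¹, by positivity⟩) hbound).isClosed_range
      R.uniformContinuous
  have htop : LinearMap.range R.toLinearMap = ⊤ := by
    have : CompleteSpace (LinearMap.range R.toLinearMap) :=
      IsClosed.completeSpace_coe (s := Set.range R) (hs := hclosedR)
    rw [← Submodule.orthogonal_eq_bot_iff, Submodule.eq_bot_iff]
    intro u hu
    refine hker u fun x => ?_
    refine (Submodule.mem_orthogonal _ u).1 hu _ ?_
    exact ⟨⟨((x : H), S x), LinearPMap.le_graph_of_le S.le_closure (S.mem_graph x)⟩, rfl⟩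
  -- By surjectivity of `R`, some `q` in the graph of the closure has the same image under "operator
  -- plus `c`" as `p`. Then `p - q` lies in the kernel of `S.adjoint + c`, so its first component is
  -- orthogonal to the range of `S + c` and vanishes.
  have hTB : S.adjoint ≤ S.closure := by
    rw [← LinearPMap.le_graph_iff]
    intro p hp
    have hmem : p.2 + c • p.1 ∈ LinearMap.range R.toLinearMap := htop ▸ Submodule.mem_top
    obtain ⟨q, hq⟩ := hmem
    change q.1.2 + c • q.1.1 = p.2 + c • p.1 at hq
    have hd : p - q.1 ∈ S.adjoint.graph :=
      Submodule.sub_mem _ hp (LinearPMap.le_graph_of_le hBT q.2)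
    have hd1 : p.1 - q.1.1 = 0 := by
      refine hker _ fun x => ?_
      obtain ⟨z, hz1, hz2⟩ := (LinearPMap.mem_graph_iff _).1 hd
      simp only [Prod.fst_sub, Prod.snd_sub] at hz1 hz2
      have h := (LinearPMap.adjoint_isFormalAdjoint hdense).symm x z
      rw [hz1, hz2] at h
      have e : p.2 - q.1.2 = -(c • (p.1 - q.1.1)) := by
        rw [smul_sub, eq_neg_iff_add_eq_zero, ← sub_eq_zero.2 hq.symm]
        abel
      rw [inner_add_left, h, e, inner_neg_right, real_inner_smul_right, real_inner_smul_left]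
      ring
    have h1 : p.1 = q.1.1 := sub_eq_zero.1 hd1
    have h2 : p.2 = q.1.2 := by
      rw [h1] at hq
      exact (add_right_cancel hq).symm
    have : p = q.1 := Prod.ext h1 h2
    rw [this]
    exact q.2
  have heq : S.closure = S.adjoint := le_antisymm hBT hTB
  refine ⟨hdense, hclosable, ?_⟩
  rw [LinearPMap.isSelfAdjoint_def]
  refine le_antisymm ?_ ?_
  · refine le_trans (LinearPMap.IsFormalAdjoint.le_adjoint hdense ?_) hTB
    intro x y
    have hx : (x : H) ∈ S.closure.domain := S.le_closure.1 x.2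
    rw [← (LinearPMap.adjoint_isFormalAdjoint hdenseB).symm ⟨x, hx⟩ y]
    congr 1
    exact S.le_closure.2 rfl
  · rw [← heq] at hformal
    exact hformal.le_adjoint hdenseB

/-! ### Local finiteness and finitely supported functions -/

theorem tsum_subtype_eq_sum_of_mem_iff {α : Type*} {p : α → Prop} (f : α → ℝ) (s : Finset α)
    (h : ∀ x, x ∈ s ↔ p x) : ∑' x : {x // p x}, f x = ∑ x ∈ s, f x := by
  obtain rfl : (fun x => x ∈ s) = p := funext fun x => propext (h x)
  exact s.tsum_subtype f

theorem finsum_subtype_eq_sum_of_mem_iff {α : Type*} {p : α → Prop} (f : α → ℝ) (s : Finset α)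
    (h : ∀ x, x ∈ s ↔ p x) : ∑ᶠ x : {x // p x}, f x = ∑ x ∈ s, f x := by
  obtain rfl : (fun x => x ∈ s) = p := funext fun x => propext (h x)
  rw [finsum_eq_sum_of_fintype]
  exact Finset.sum_coe_sort s f

namespace WeightedComplex

variable {V : Type*} {K : WeightedComplex V}

/-- Every simplex has finitely many cofaces. -/
def LocallyFinite (K : WeightedComplex V) : Prop := ∀ τ : K.Simplex, Finite (K.Cofaces τ)

/-- A convergent series has only finitely many terms that are at least `c`, and here all of them
are. -/
theorem LocallySummable.locallyFinite (hsum : K.LocallySummable) (hpos : K.UniformlyPositive) :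
    K.LocallyFinite := by
  obtain ⟨c, hc, hm⟩ := hpos
  intro τ
  have h := (hsum τ).tendsto_cofinite_zero.eventually (gt_mem_nhds hc)
  rw [Filter.eventually_cofinite] at h
  exact Set.finite_univ_iff.1 (h.subset fun σ _ => not_lt.2 (hm σ.1))

/-- The faces of `σ` as a finite set. -/
def faceFinset (σ : K.Simplex) : Finset K.Simplex :=
  (show {τ | IsFace τ σ}.Finite from K.finite_faces σ).toFinset

@[simp]
theorem mem_faceFinset {τ σ : K.Simplex} : τ ∈ faceFinset σ ↔ IsFace τ σ :=
  Set.Finite.mem_toFinset _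

namespace LocallyFinite

variable (hK : K.LocallyFinite)

/-- The cofaces of `τ` as a finite set. -/
def cofaceFinset (τ : K.Simplex) : Finset K.Simplex :=
  (show {σ | IsFace τ σ}.Finite from hK τ).toFinset

@[simp]
theorem mem_cofaceFinset {τ σ : K.Simplex} : σ ∈ hK.cofaceFinset τ ↔ IsFace τ σ :=
  Set.Finite.mem_toFinset _

include hK in
theorem F1_eq_top : K.F1 = ⊤ := by
  refine (Submodule.eq_top_iff').2 fun ω τ => ?_
  have := hK τ
  exact summable_of_hasFiniteSupport (Set.toFinite _)

end LocallyFinite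

theorem Fc_iff_exists_finset {ω : K.Fun} : ω ∈ K.Fc ↔ ∃ T : Finset K.Simplex, ∀ τ ∉ T, ω τ = 0 := by
  constructor
  · intro h
    refine ⟨Set.Finite.toFinset h, fun τ hτ => ?_⟩
    by_contra h0
    exact hτ ((Set.Finite.mem_toFinset _).2 h0)
  · rintro ⟨T, hT⟩
    refine T.finite_toSet.subset fun τ hτ => ?_
    by_contra h0
    exact hτ (hT τ h0)

theorem char_self (τ : K.Simplex) : K.char τ τ = 1 := by simp [char]

theorem char_of_ne {τ σ : K.Simplex} (h : σ ≠ τ) : K.char τ σ = 0 := by simp [char, h]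

theorem char_mem_Fc (τ : K.Simplex) : K.char τ ∈ K.Fc :=
  Fc_iff_exists_finset.2 ⟨{τ}, fun _ hσ => char_of_ne (by simpa using hσ)⟩

/-! ### `δ` and `∂` as finite sums -/

namespace Coboundary

variable (δ : K.Coboundary)

theorem sign_eq_zero {τ σ : K.Simplex} (h : ¬ IsFace τ σ) : δ.sign τ σ = 0 := by
  by_contra h0
  exact h ((δ.sign_ne_zero_iff τ σ).1 h0)

theorem sign_mul_self {τ σ : K.Simplex} (h : IsFace τ σ) : δ.sign τ σ * δ.sign τ σ = 1 := by
  have h0 : δ.sign τ σ ≠ 0 := (δ.sign_ne_zero_iff τ σ).2 h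
  have h1 : δ.sign τ σ ∈ ({-1, 0, 1} : Set ℝ) := δ.sign_values τ σ
  rcases h1 with h1 | h1 | h1
  · rw [h1]; norm_num
  · exact absurd h1 h0
  · rw [h1]; norm_num

theorem apply_eq_sum_faceFinset (ω : K.Fun) (σ : K.Simplex) :
    δ.toLinearMap ω σ = ∑ τ ∈ faceFinset σ, ω τ * δ.sign τ σ := by
  rw [δ.apply_eq]
  exact finsum_subtype_eq_sum_of_mem_iff (fun τ => ω τ * δ.sign τ σ) _ fun _ => mem_faceFinset

/-- The sign vanishes off the faces of `σ`, and `ω` on the faces outside `T`. The freedom in `T`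
allows one index set for all `σ`, so that double sums can be interchanged. -/
theorem apply_eq_sum (ω : K.Fun) (σ : K.Simplex) {T : Finset K.Simplex}
    (hT : ∀ τ, IsFace τ σ → τ ∉ T → ω τ = 0) :
    δ.toLinearMap ω σ = ∑ τ ∈ T, ω τ * δ.sign τ σ := by
  classical
  rw [apply_eq_sum_faceFinset]
  refine (Finset.sum_subset Finset.subset_union_left (s₂ := faceFinset σ ∪ T) ?_).trans
    (Finset.sum_subset Finset.subset_union_right ?_).symm
  · intro τ _ hτ
    rw [δ.sign_eq_zero (by simpa using hτ), mul_zero]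
  · intro τ hτ hT'
    rw [hT τ (by simpa [hT'] using hτ) hT', zero_mul]

/-- The boundary operator of a locally finite complex, which is defined on all functions. -/
def boundaryLM (hK : K.LocallyFinite) : K.Fun →ₗ[ℝ] K.Fun :=
  δ.boundary.toFun ∘ₗ (LinearEquiv.ofTop K.F1 hK.F1_eq_top).symm.toLinearMap

variable (hK : K.LocallyFinite)

theorem boundary_eq_toPMap : δ.boundary = (δ.boundaryLM hK).toPMap ⊤ := by
  refine LinearPMap.ext hK.F1_eq_top fun x hx hx' => rfl

theorem boundaryLM_eq_sum_cofaceFinset (ω : K.Fun) (ρ : K.Simplex) :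
    δ.boundaryLM hK ω ρ = (K.m ρ)⁻¹ * ∑ τ ∈ hK.cofaceFinset ρ, K.m τ * ω τ * δ.sign ρ τ := by
  change (K.m ρ)⁻¹ * ∑' τ : K.Cofaces ρ, K.m τ.1 * ω τ.1 * δ.sign ρ τ.1 = _
  rw [tsum_subtype_eq_sum_of_mem_iff (fun τ => K.m τ * ω τ * δ.sign ρ τ) (hK.cofaceFinset ρ)
    fun _ => hK.mem_cofaceFinset]

theorem m_mul_boundaryLM (ω : K.Fun) (ρ : K.Simplex) {T : Finset K.Simplex}
    (hT : ∀ τ, IsFace ρ τ → τ ∉ T → ω τ = 0) :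
    K.m ρ * δ.boundaryLM hK ω ρ = ∑ τ ∈ T, K.m τ * ω τ * δ.sign ρ τ := by
  classical
  rw [boundaryLM_eq_sum_cofaceFinset, mul_inv_cancel_left₀ (K.m_pos ρ).ne']
  refine (Finset.sum_subset Finset.subset_union_left (s₂ := hK.cofaceFinset ρ ∪ T) ?_).trans
    (Finset.sum_subset Finset.subset_union_right ?_).symm
  · intro τ _ hτ
    rw [δ.sign_eq_zero (by simpa using hτ), mul_zero]
  · intro τ hτ hT'
    rw [hT τ (by simpa [hT'] using hτ) hT', mul_zero, zero_mul]

include hK in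
-- The support of `δω` lies among the cofaces of the support of `ω`; finiteness of their number is
-- what local finiteness provides.
theorem toLinearMap_mem_Fc {ω : K.Fun} (h : ω ∈ K.Fc) : δ.toLinearMap ω ∈ K.Fc := by
  classical
  obtain ⟨T, hT⟩ := Fc_iff_exists_finset.1 h
  refine Fc_iff_exists_finset.2 ⟨T.biUnion hK.cofaceFinset, fun σ hσ => ?_⟩
  rw [δ.apply_eq_sum ω σ (T := ∅) fun τ hτ _ => ?_, Finset.sum_empty]
  by_contra h0
  exact hσ (Finset.mem_biUnion.2 ⟨τ, by_contra fun h' => h0 (hT τ h'), by simpa using hτ⟩)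

theorem boundaryLM_mem_Fc {ω : K.Fun} (h : ω ∈ K.Fc) : δ.boundaryLM hK ω ∈ K.Fc := by
  classical
  obtain ⟨T, hT⟩ := Fc_iff_exists_finset.1 h
  refine Fc_iff_exists_finset.2 ⟨T.biUnion faceFinset, fun ρ hρ => ?_⟩
  have h1 := δ.m_mul_boundaryLM hK ω ρ (T := ∅) fun τ hτ _ => by
    by_contra h0
    exact hρ (Finset.mem_biUnion.2 ⟨τ, by_contra fun h' => h0 (hT τ h'), by simpa using hτ⟩)
  rw [Finset.sum_empty] at h1
  exact (mul_eq_zero.1 h1).resolve_left (K.m_pos ρ).ne'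

end Coboundary

/-! ### Formal adjointness of `δ` and `∂` -/

/-- The pairing `∑ m ω η`, meaningful if one of the two functions is finitely supported. -/
def pairing (ω η : K.Fun) : ℝ := ∑' σ, K.m σ * ω σ * η σ

theorem pairing_eq_sum {ω : K.Fun} (η : K.Fun) {T : Finset K.Simplex} (hT : ∀ τ ∉ T, ω τ = 0) :
    pairing ω η = ∑ σ ∈ T, K.m σ * ω σ * η σ :=
  tsum_eq_sum fun σ hσ => by rw [hT σ hσ, mul_zero, zero_mul]

theorem pairing_char (τ : K.Simplex) (η : K.Fun) : pairing (K.char τ) η = K.m τ * η τ := by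
  rw [pairing_eq_sum η (T := {τ}) fun _ hσ => char_of_ne (by simpa using hσ)]
  simp [char_self]

theorem pairing_add_left {ω ω' : K.Fun} (h : ω ∈ K.Fc) (h' : ω' ∈ K.Fc) (η : K.Fun) :
    pairing (ω + ω') η = pairing ω η + pairing ω' η := by
  classical
  obtain ⟨T, hT⟩ := Fc_iff_exists_finset.1 h
  obtain ⟨T', hT'⟩ := Fc_iff_exists_finset.1 h'
  rw [pairing_eq_sum η (T := T ∪ T') fun τ hτ => ?_,
    pairing_eq_sum η (T := T ∪ T') fun τ hτ => hT τ fun h => hτ (Finset.mem_union_left _ h),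
    pairing_eq_sum η (T := T ∪ T') fun τ hτ => hT' τ fun h => hτ (Finset.mem_union_right _ h),
    ← Finset.sum_add_distrib]
  · exact Finset.sum_congr rfl fun σ _ => by simp only [Pi.add_apply]; ring
  · rw [Pi.add_apply, hT τ fun h => hτ (Finset.mem_union_left _ h),
      hT' τ fun h => hτ (Finset.mem_union_right _ h), add_zero]

theorem pairing_add_right {ω : K.Fun} (h : ω ∈ K.Fc) (η η' : K.Fun) :
    pairing ω (η + η') = pairing ω η + pairing ω η' := by
  obtain ⟨T, hT⟩ := Fc_iff_exists_finset.1 h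
  rw [pairing_eq_sum _ hT, pairing_eq_sum _ hT, pairing_eq_sum _ hT, ← Finset.sum_add_distrib]
  exact Finset.sum_congr rfl fun σ _ => by simp only [Pi.add_apply]; ring

namespace Coboundary

variable (δ : K.Coboundary) (hK : K.LocallyFinite)

theorem pairing_toLinearMap {ω : K.Fun} (h : ω ∈ K.Fc) (η : K.Fun) :
    pairing (δ.toLinearMap ω) η = pairing ω (δ.boundaryLM hK η) := by
  classical
  obtain ⟨T, hT⟩ := Fc_iff_exists_finset.1 h
  obtain ⟨S', hS'⟩ := Fc_iff_exists_finset.1 (δ.toLinearMap_mem_Fc hK h)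
  -- `S` contains the support of `δω` and all cofaces of elements of `T`, so both sides become sums
  -- over `S × T`.
  set S := S' ∪ T.biUnion hK.cofaceFinset
  rw [pairing_eq_sum η (T := S) fun τ hτ => hS' τ fun h => hτ (Finset.mem_union_left _ h),
    pairing_eq_sum _ hT]
  have e : ∀ τ ∈ T, K.m τ * ω τ * δ.boundaryLM hK η τ =
      ∑ σ ∈ S, K.m σ * (ω τ * δ.sign τ σ) * η σ := by
    intro τ hτ
    rw [mul_right_comm, δ.m_mul_boundaryLM hK η τ (T := S), Finset.sum_mul]
    · exact Finset.sum_congr rfl fun σ _ => by ring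
    · intro σ hσ hσS
      exact absurd (Finset.mem_union_right _ (Finset.mem_biUnion.2 ⟨τ, hτ, by simpa using hσ⟩)) hσS
  rw [Finset.sum_congr rfl e, Finset.sum_comm]
  refine Finset.sum_congr rfl fun σ _ => ?_
  rw [δ.apply_eq_sum ω σ fun τ _ => hT τ, Finset.mul_sum, Finset.sum_mul]

theorem pairing_boundaryLM {ω : K.Fun} (h : ω ∈ K.Fc) (η : K.Fun) :
    pairing (δ.boundaryLM hK ω) η = pairing ω (δ.toLinearMap η) := by
  classical
  obtain ⟨T, hT⟩ := Fc_iff_exists_finset.1 h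
  obtain ⟨S', hS'⟩ := Fc_iff_exists_finset.1 (δ.boundaryLM_mem_Fc hK h)
  set S := S' ∪ T.biUnion faceFinset
  rw [pairing_eq_sum η (T := S) fun τ hτ => hS' τ fun h => hτ (Finset.mem_union_left _ h),
    pairing_eq_sum _ hT]
  have e : ∀ τ ∈ T, K.m τ * ω τ * δ.toLinearMap η τ =
      ∑ ρ ∈ S, K.m τ * ω τ * δ.sign ρ τ * η ρ := by
    intro τ hτ
    rw [δ.apply_eq_sum η τ (T := S), Finset.mul_sum]
    · exact Finset.sum_congr rfl fun σ _ => by ring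
    · intro ρ hρ hρS
      exact absurd (Finset.mem_union_right _ (Finset.mem_biUnion.2 ⟨τ, hτ, by simpa using hρ⟩)) hρS
  rw [Finset.sum_congr rfl e, Finset.sum_comm]
  refine Finset.sum_congr rfl fun ρ _ => ?_
  rw [δ.m_mul_boundaryLM hK ω ρ fun τ _ => hT τ, Finset.sum_mul]

theorem toLinearMap_toLinearMap (ω : K.Fun) : δ.toLinearMap (δ.toLinearMap ω) = 0 :=
  LinearMap.congr_fun δ.comp_self ω

/-- Dual to `δδ = 0`: test against `1_τ` and move both operators across the pairing. -/
theorem boundaryLM_boundaryLM (ω : K.Fun) : δ.boundaryLM hK (δ.boundaryLM hK ω) = 0 := by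
  funext τ
  have h := pairing_char τ (δ.boundaryLM hK (δ.boundaryLM hK ω))
  rw [← δ.pairing_toLinearMap hK (char_mem_Fc τ),
    ← δ.pairing_toLinearMap hK (δ.toLinearMap_mem_Fc hK (char_mem_Fc τ)),
    toLinearMap_toLinearMap] at h
  have h0 : pairing (0 : K.Fun) ω = 0 := by simp [pairing]
  rw [h0] at h
  exact (mul_eq_zero.1 h.symm).resolve_left (K.m_pos τ).ne'

/-! ### The formal Laplacians as everywhere defined operators -/

/-- The operators `δ`, `∂`, `δ + ∂` of a locally finite complex. -/
def firstOrderLM : Kind → (K.Fun →ₗ[ℝ] K.Fun)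
  | .up => δ.toLinearMap
  | .down => δ.boundaryLM hK
  | .hodge => δ.toLinearMap + δ.boundaryLM hK

/-- The formal adjoints `∂`, `δ`, `δ + ∂` of the operators `firstOrderLM`. -/
def adjointLM : Kind → (K.Fun →ₗ[ℝ] K.Fun)
  | .up => δ.boundaryLM hK
  | .down => δ.toLinearMap
  | .hodge => δ.toLinearMap + δ.boundaryLM hK

/-- The formal Laplacians of a locally finite complex. -/
def laplacianLM (k : Kind) : K.Fun →ₗ[ℝ] K.Fun := δ.adjointLM hK k ∘ₗ δ.firstOrderLM hK k

theorem firstOrder_eq_toPMap (k : Kind) :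
    δ.firstOrder k = (δ.firstOrderLM hK k).toPMap ⊤ := by
  cases k
  · rfl
  · exact δ.boundary_eq_toPMap hK
  · change δ.coboundary + δ.boundary = _
    rw [δ.boundary_eq_toPMap hK]
    refine LinearPMap.ext ?_ fun x hx hx' => rfl
    exact inf_top_eq _

theorem pcomp_toPMap {E : Type*} [AddCommGroup E] [Module ℝ E] (B A : E →ₗ[ℝ] E) :
    pcomp (B.toPMap ⊤) (A.toPMap ⊤) = (B ∘ₗ A).toPMap ⊤ := by
  refine LinearPMap.ext ?_ fun x hx hx' => rfl
  refine (Submodule.eq_top_iff').2 fun x => ?_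
  refine ⟨?_, trivial⟩
  exact ⟨⟨x, trivial⟩, trivial, rfl⟩

theorem formalLaplacian_eq_toPMap (k : Kind) :
    δ.formalLaplacian k = (δ.laplacianLM hK k).toPMap ⊤ := by
  have hh := δ.firstOrder_eq_toPMap hK .hodge
  change δ.coboundary + δ.boundary = _ at hh
  cases k
  · change pcomp δ.boundary (δ.toLinearMap.toPMap ⊤) = _
    rw [δ.boundary_eq_toPMap hK]
    exact pcomp_toPMap _ _
  · change pcomp (δ.toLinearMap.toPMap ⊤) δ.boundary = _
    rw [δ.boundary_eq_toPMap hK]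
    exact pcomp_toPMap _ _
  · change pcomp (δ.coboundary + δ.boundary) (δ.coboundary + δ.boundary) = _
    rw [hh]
    exact pcomp_toPMap _ _

theorem firstOrderLM_mem_Fc (k : Kind) {ω : K.Fun} (h : ω ∈ K.Fc) :
    δ.firstOrderLM hK k ω ∈ K.Fc := by
  cases k
  · exact δ.toLinearMap_mem_Fc hK h
  · exact δ.boundaryLM_mem_Fc hK h
  · exact add_mem (δ.toLinearMap_mem_Fc hK h) (δ.boundaryLM_mem_Fc hK h)

theorem adjointLM_mem_Fc (k : Kind) {ω : K.Fun} (h : ω ∈ K.Fc) :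
    δ.adjointLM hK k ω ∈ K.Fc := by
  cases k
  · exact δ.boundaryLM_mem_Fc hK h
  · exact δ.toLinearMap_mem_Fc hK h
  · exact add_mem (δ.toLinearMap_mem_Fc hK h) (δ.boundaryLM_mem_Fc hK h)

theorem laplacianLM_mem_Fc (k : Kind) {ω : K.Fun} (h : ω ∈ K.Fc) :
    δ.laplacianLM hK k ω ∈ K.Fc :=
  δ.adjointLM_mem_Fc hK k (δ.firstOrderLM_mem_Fc hK k h)

theorem pairing_dirac {ω : K.Fun} (h : ω ∈ K.Fc) (η : K.Fun) :
    pairing ((δ.toLinearMap + δ.boundaryLM hK) ω) η =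
      pairing ω ((δ.toLinearMap + δ.boundaryLM hK) η) := by
  simp only [LinearMap.add_apply]
  rw [pairing_add_left (δ.toLinearMap_mem_Fc hK h) (δ.boundaryLM_mem_Fc hK h),
    pairing_add_right h, δ.pairing_toLinearMap hK h, δ.pairing_boundaryLM hK h, add_comm]

theorem pairing_firstOrderLM (k : Kind) {ω : K.Fun} (h : ω ∈ K.Fc) (η : K.Fun) :
    pairing (δ.firstOrderLM hK k ω) η = pairing ω (δ.adjointLM hK k η) := by
  cases k
  · exact δ.pairing_toLinearMap hK h η
  · exact δ.pairing_boundaryLM hK h η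
  · exact δ.pairing_dirac hK h η

theorem pairing_adjointLM (k : Kind) {ω : K.Fun} (h : ω ∈ K.Fc) (η : K.Fun) :
    pairing (δ.adjointLM hK k ω) η = pairing ω (δ.firstOrderLM hK k η) := by
  cases k
  · exact δ.pairing_boundaryLM hK h η
  · exact δ.pairing_toLinearMap hK h η
  · exact δ.pairing_dirac hK h η

theorem pairing_laplacianLM (k : Kind) {ω : K.Fun} (h : ω ∈ K.Fc) (η : K.Fun) :
    pairing (δ.laplacianLM hK k ω) η = pairing ω (δ.laplacianLM hK k η) := by
  simp only [laplacianLM, LinearMap.comp_apply]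
  rw [δ.pairing_adjointLM hK k (δ.firstOrderLM_mem_Fc hK k h), δ.pairing_firstOrderLM hK k h]

theorem laplacianLM_hodge_apply (ω : K.Fun) :
    δ.laplacianLM hK .hodge ω =
      δ.boundaryLM hK (δ.toLinearMap ω) + δ.toLinearMap (δ.boundaryLM hK ω) := by
  change (δ.toLinearMap + δ.boundaryLM hK) ((δ.toLinearMap + δ.boundaryLM hK) ω) = _
  simp only [LinearMap.add_apply, map_add, toLinearMap_toLinearMap, boundaryLM_boundaryLM]
  abel

/-- An eigenfunction of an up- or down-Laplacian with nonzero eigenvalue is one of the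
Hodge Laplacian. -/
theorem laplacianLM_hodge_of_eigen (k : Kind) {ω : K.Fun} {c : ℝ} (hc : c ≠ 0)
    (h : δ.laplacianLM hK k ω = c • ω) : δ.laplacianLM hK .hodge ω = c • ω := by
  cases k
  · change δ.boundaryLM hK (δ.toLinearMap ω) = c • ω at h
    -- Applying `∂` to `∂δω = cω` kills the left side, so the missing summand `δ∂ω` of the Hodge
    -- Laplacian is zero.
    have h0 : δ.boundaryLM hK ω = 0 := by
      have h1 := congrArg (δ.boundaryLM hK) h
      rw [boundaryLM_boundaryLM, map_smul] at h1
      exact (smul_eq_zero.1 h1.symm).resolve_left hc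
    rw [laplacianLM_hodge_apply, h, h0, map_zero, add_zero]
  · change δ.toLinearMap (δ.boundaryLM hK ω) = c • ω at h
    have h0 : δ.toLinearMap ω = 0 := by
      have h1 := congrArg δ.toLinearMap h
      rw [toLinearMap_toLinearMap, map_smul] at h1
      exact (smul_eq_zero.1 h1.symm).resolve_left hc
    rw [laplacianLM_hodge_apply, h, h0, map_zero, zero_add]
  · exact h

end Coboundary

/-! ### Combinatorics of faces and cofaces -/

/-- Only the empty simplex can be missing from `Σ`, and erasing one of at least two vertices leaves
a non-empty set. -/
theorem card_le_one_of_forall_not_isFace {τ : K.Simplex}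
    (h₀ : ∀ ρ, ¬ IsFace ρ τ) : τ.1.card ≤ 1 := by
  classical
  by_contra! hcard
  obtain ⟨v, hv⟩ := Finset.card_pos.1 (zero_lt_one.trans hcard)
  have he := Finset.card_erase_add_one hv
  have hmem : τ.1.erase v ∈ K.carrier :=
    ⟨K.down_closed _ τ.2.1 _ (Finset.erase_subset _ _),
      Or.inl (Finset.card_pos.1 (by omega))⟩
  exact h₀ ⟨_, hmem⟩ ⟨Finset.erase_subset _ _, he.symm⟩

namespace IsFace

/-- Two distinct faces of `σ` have a union strictly larger than `τ`, hence as large as `σ`; the rest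
is inclusion-exclusion. -/
theorem card_inter [DecidableEq V] {τ τ' σ : K.Simplex} (h : IsFace τ σ) (h' : IsFace τ' σ)
    (hne : τ' ≠ τ) : (τ.1 ∩ τ'.1).card + 1 = τ.1.card := by
  have hlt : τ.1.card < (τ.1 ∪ τ'.1).card := by
    refine Finset.card_lt_card ⟨Finset.subset_union_left, fun hs => hne ?_⟩
    refine Subtype.ext (Finset.eq_of_subset_of_card_le
      (Finset.subset_union_right.trans hs) ?_)
    have := h.2
    have := h'.2
    omega
  have hle : (τ.1 ∪ τ'.1).card ≤ σ.1.card := Finset.card_le_card (Finset.union_subset h.1 h'.1)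
  have := Finset.card_union_add_card_inter τ.1 τ'.1
  have := h.2
  have := h'.2
  omega

theorem eq_inter [DecidableEq V] {ρ τ τ' : K.Simplex} (h : IsFace ρ τ) (h' : IsFace ρ τ')
    (hne : τ' ≠ τ) : ρ.1 = τ.1 ∩ τ'.1 := by
  refine Finset.eq_of_subset_of_card_le (Finset.subset_inter h.1 h'.1) ?_
  have hlt : (τ.1 ∩ τ'.1).card < τ.1.card := by
    refine Finset.card_lt_card ⟨Finset.inter_subset_left, fun hs => hne ?_⟩
    refine (Subtype.ext (Finset.eq_of_subset_of_card_le
      (hs.trans Finset.inter_subset_right) ?_)).symm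
    have := h.2
    have := h'.2
    omega
  have := h.2
  omega

/-- Two faces of `σ` that contain a common simplex of codimension two are the only ones. -/
theorem eq_or_eq {ρ τ τ' π σ : K.Simplex} (h₁ : IsFace ρ τ) (h₂ : IsFace τ σ)
    (h₁' : IsFace ρ τ') (h₂' : IsFace τ' σ) (hne : τ' ≠ τ) (h₃ : IsFace ρ π) (h₄ : IsFace π σ) :
    π = τ ∨ π = τ' := by
  classical
  by_contra! hπ
  -- A third `π` would meet both `τ` and `τ'` exactly in `ρ`; as `τ ∪ τ' = σ`, this forces `π = ρ`.
  have e₁ := h₁.eq_inter h₃ hπ.1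
  have e₂ := h₁'.eq_inter h₃ hπ.2
  have hunion : τ.1 ∪ τ'.1 = σ.1 := by
    refine Finset.eq_of_subset_of_card_le (Finset.union_subset h₂.1 h₂'.1) ?_
    have := Finset.card_union_add_card_inter τ.1 τ'.1
    have := h₂.card_inter h₂' hne
    have := h₂.2
    have := h₂'.2
    omega
  have e : π.1 = ρ.1 := by
    rw [← Finset.inter_eq_right.2 h₄.1, ← hunion, Finset.union_inter_distrib_right, ← e₁, ← e₂,
      Finset.union_self]
  have := h₃.2
  rw [e] at this
  omega

/-- Two faces of a simplex have a common face, provided that one of them has a face in the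
complex. -/
theorem exists_common_face {ρ₀ τ τ' σ : K.Simplex} (h₀ : IsFace ρ₀ τ) (h : IsFace τ σ)
    (h' : IsFace τ' σ) (hne : τ' ≠ τ) : ∃ ρ : K.Simplex, IsFace ρ τ ∧ IsFace ρ τ' := by
  classical
  have hcard := h.card_inter h' hne
  have hmem : τ.1 ∩ τ'.1 ∈ K.carrier := by
    refine ⟨K.down_closed _ τ.2.1 _ Finset.inter_subset_left, ?_⟩
    -- If `ρ₀` is non-empty, so is `τ ∩ τ'`, which has as many vertices; otherwise the vertex
    -- weights are summable and `∅` is admitted to `Σ`.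
    rcases ρ₀.2.2 with hn | hs
    · left
      rw [← Finset.card_pos] at hn ⊢
      have := h₀.2
      omega
    · exact Or.inr hs
  refine ⟨⟨_, hmem⟩, ⟨Finset.inter_subset_left, hcard.symm⟩, Finset.inter_subset_right, ?_⟩
  have := h.2
  have := h'.2
  change τ'.1.card = (τ.1 ∩ τ'.1).card + 1
  omega

/-- If `τ` has no face, a coface of `τ` has at most one other face. -/
theorem card_erase_faceFinset_le [DecidableEq K.Simplex] {τ σ : K.Simplex} (h : IsFace τ σ)
    (h₀ : ∀ ρ, ¬ IsFace ρ τ) : ((faceFinset σ).erase τ).card ≤ 1 := by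
  classical
  have hcard := card_le_one_of_forall_not_isFace h₀
  -- Since `τ` has at most one vertex, `τ ∩ τ'` has none, and `τ'` must be the complement of `τ` in
  -- `σ`.
  have key : ∀ τ' ∈ (faceFinset σ).erase τ, τ'.1 = σ.1 \ τ.1 := by
    intro τ' hτ'
    rw [Finset.mem_erase, mem_faceFinset] at hτ'
    have hi := h.card_inter hτ'.2 hτ'.1
    have hd : Disjoint τ'.1 τ.1 := by
      rw [disjoint_comm, Finset.disjoint_iff_inter_eq_empty, ← Finset.card_eq_zero]
      omega
    refine Finset.eq_of_subset_of_card_le (Finset.subset_sdiff.2 ⟨hτ'.2.1, hd⟩) ?_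
    rw [Finset.card_sdiff_of_subset h.1]
    have := h.2
    have := hτ'.2.2
    omega
  exact Finset.card_le_one.2 fun a ha b hb => Subtype.ext ((key a ha).trans (key b hb).symm)

end IsFace

/-! ### Sign relations and the curvature bound at a maximum -/

namespace Coboundary

variable (δ : K.Coboundary)

/-- This is `δδ1_ρ(σ) = 0`: only `τ` and `τ'` lie between `ρ` and `σ`. -/
theorem sign_mul_sign_add {ρ τ τ' σ : K.Simplex} (h₁ : IsFace ρ τ) (h₂ : IsFace τ σ)
    (h₁' : IsFace ρ τ') (h₂' : IsFace τ' σ) (hne : τ' ≠ τ) :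
    δ.sign ρ τ * δ.sign τ σ + δ.sign ρ τ' * δ.sign τ' σ = 0 := by
  classical
  have h := congrFun (δ.toLinearMap_toLinearMap (K.char ρ)) σ
  rw [δ.apply_eq_sum _ σ (T := {τ, τ'}), Finset.sum_pair hne.symm] at h
  · exact h
  · intro π hπ hπT
    refine δ.sign_eq_zero fun h₃ => hπT ?_
    rcases h₁.eq_or_eq h₂ h₁' h₂' hne h₃ hπ with rfl | rfl <;> simp

/-- The right side does not depend on `σ`: all common cofaces contribute with one sign, opposite to
that of the common face. This produces the difference inside the absolute value in `c^H`. -/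
theorem sign_mul_sign_coface {ρ τ τ' σ : K.Simplex} (h₁ : IsFace ρ τ) (h₂ : IsFace τ σ)
    (h₁' : IsFace ρ τ') (h₂' : IsFace τ' σ) (hne : τ' ≠ τ) :
    δ.sign τ σ * δ.sign τ' σ = -(δ.sign ρ τ * δ.sign ρ τ') := by
  linear_combination (δ.sign ρ τ * δ.sign τ' σ) * δ.sign_mul_sign_add h₁ h₂ h₁' h₂' hne
    - δ.sign τ σ * δ.sign τ' σ * δ.sign_mul_self h₁
    - δ.sign ρ τ * δ.sign ρ τ' * δ.sign_mul_self h₂'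

variable (hK : K.LocallyFinite)

theorem m_mul_boundaryLM_toLinearMap [DecidableEq K.Simplex] (u : K.Fun) (τ : K.Simplex) :
    K.m τ * δ.boundaryLM hK (δ.toLinearMap u) τ =
      (∑ σ ∈ hK.cofaceFinset τ, K.m σ) * u τ +
        ∑ σ ∈ hK.cofaceFinset τ, ∑ τ' ∈ (faceFinset σ).erase τ,
          K.m σ * (δ.sign τ σ * δ.sign τ' σ) * u τ' := by
  rw [δ.m_mul_boundaryLM hK _ τ (T := hK.cofaceFinset τ)
    fun σ hσ h => absurd (hK.mem_cofaceFinset.2 hσ) h, Finset.sum_mul, ← Finset.sum_add_distrib]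
  refine Finset.sum_congr rfl fun σ hσ => ?_
  rw [hK.mem_cofaceFinset] at hσ
  rw [apply_eq_sum_faceFinset, ← Finset.add_sum_erase _ _ (mem_faceFinset.2 hσ), mul_add, add_mul,
    Finset.mul_sum, Finset.sum_mul]
  congr 1
  · linear_combination K.m σ * u τ * δ.sign_mul_self hσ
  · exact Finset.sum_congr rfl fun τ' _ => by ring

theorem m_mul_toLinearMap_boundaryLM [DecidableEq K.Simplex] (u : K.Fun) (τ : K.Simplex) :
    K.m τ * δ.toLinearMap (δ.boundaryLM hK u) τ =
      (∑ ρ ∈ faceFinset τ, K.m τ ^ 2 / K.m ρ) * u τ +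
        ∑ ρ ∈ faceFinset τ, ∑ τ' ∈ (hK.cofaceFinset ρ).erase τ,
          K.m τ * K.m τ' / K.m ρ * (δ.sign ρ τ * δ.sign ρ τ') * u τ' := by
  rw [apply_eq_sum_faceFinset, Finset.mul_sum, Finset.sum_mul, ← Finset.sum_add_distrib]
  refine Finset.sum_congr rfl fun ρ hρ => ?_
  rw [mem_faceFinset] at hρ
  rw [boundaryLM_eq_sum_cofaceFinset, ← Finset.add_sum_erase _ _ (hK.mem_cofaceFinset.2 hρ),
    mul_add, add_mul, mul_add, Finset.mul_sum, Finset.sum_mul, Finset.mul_sum]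
  congr 1
  · linear_combination K.m τ ^ 2 / K.m ρ * u τ * δ.sign_mul_self hρ
  · exact Finset.sum_congr rfl fun τ' _ => by ring

end Coboundary

theorem LocallyFinite.curvatureH_eq [DecidableEq K.Simplex] (hK : K.LocallyFinite)
    (τ : K.Simplex) :
    K.curvatureH τ = ∑ ρ ∈ faceFinset τ, K.m τ ^ 2 / K.m ρ + ∑ σ ∈ hK.cofaceFinset τ, K.m σ -
      ∑ ρ ∈ faceFinset τ, ∑ τ' ∈ (hK.cofaceFinset ρ).erase τ,
        |K.m τ * K.m τ' / K.m ρ - ∑ σ ∈ hK.cofaceFinset τ ∩ hK.cofaceFinset τ', K.m σ| := by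
  have hσ : ∀ τ' : K.Simplex, ∑' σ : {σ : K.Simplex // IsFace τ σ ∧ IsFace τ' σ}, K.m σ.1 =
      ∑ σ ∈ hK.cofaceFinset τ ∩ hK.cofaceFinset τ', K.m σ := fun τ' =>
    tsum_subtype_eq_sum_of_mem_iff K.m _ (by simp)
  unfold curvatureH
  simp only [hσ]
  congr 1
  · congr 1
    · exact finsum_subtype_eq_sum_of_mem_iff (fun ρ => K.m τ ^ 2 / K.m ρ) _ fun _ => mem_faceFinset
    · exact tsum_subtype_eq_sum_of_mem_iff K.m _ fun _ => hK.mem_cofaceFinset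
  · refine (finsum_subtype_eq_sum_of_mem_iff (fun ρ : K.Simplex =>
      ∑' τ' : {τ' : K.Simplex // IsFace ρ τ' ∧ τ' ≠ τ}, |K.m τ * K.m τ'.1 / K.m ρ -
        ∑ σ ∈ hK.cofaceFinset τ ∩ hK.cofaceFinset τ'.1, K.m σ|) _ fun _ => mem_faceFinset).trans ?_
    refine Finset.sum_congr rfl fun ρ _ => ?_
    exact tsum_subtype_eq_sum_of_mem_iff (fun τ' : K.Simplex => |K.m τ * K.m τ' / K.m ρ -
      ∑ σ ∈ hK.cofaceFinset τ ∩ hK.cofaceFinset τ', K.m σ|) _ (by simp [and_comm])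

/-- If `τ` has a face, the sum over pairs of a coface `σ ≻ τ` and another face `τ'` of `σ` can be
arranged by the common face of `τ` and `τ'`. -/
theorem LocallyFinite.sum_coface_face_eq [DecidableEq K.Simplex] (hK : K.LocallyFinite)
    {ρ₀ τ : K.Simplex} (h₀ : IsFace ρ₀ τ) (f : K.Simplex → K.Simplex → ℝ) :
    ∑ σ ∈ hK.cofaceFinset τ, ∑ τ' ∈ (faceFinset σ).erase τ, f σ τ' =
      ∑ ρ ∈ faceFinset τ, ∑ τ' ∈ (hK.cofaceFinset ρ).erase τ,
        ∑ σ ∈ hK.cofaceFinset τ ∩ hK.cofaceFinset τ', f σ τ' := by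
  classical
  have h1 : ∀ σ ∈ hK.cofaceFinset τ, ∑ τ' ∈ (faceFinset σ).erase τ, f σ τ' =
      ∑ ρ ∈ faceFinset τ, ∑ τ' ∈ (faceFinset σ).erase τ ∩ hK.cofaceFinset ρ, f σ τ' := by
    intro σ hσ
    rw [hK.mem_cofaceFinset] at hσ
    -- The common face of `τ` and `τ'` exists and is unique, so summing over common faces inserts a
    -- factor one.
    have h2 : ∀ τ' ∈ (faceFinset σ).erase τ,
        f σ τ' = ∑ ρ ∈ faceFinset τ ∩ faceFinset τ', f σ τ' := by
      intro τ' hτ'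
      rw [Finset.mem_erase, mem_faceFinset] at hτ'
      obtain ⟨ρ, hρ, hρ'⟩ := h₀.exists_common_face hσ hτ'.2 hτ'.1
      have : faceFinset τ ∩ faceFinset τ' = {ρ} := by
        ext π
        simp only [Finset.mem_inter, mem_faceFinset, Finset.mem_singleton]
        constructor
        · rintro ⟨h, h'⟩
          exact Subtype.ext ((h.eq_inter h' hτ'.1).trans (hρ.eq_inter hρ' hτ'.1).symm)
        · rintro rfl
          exact ⟨hρ, hρ'⟩
      rw [this, Finset.sum_singleton]
    rw [Finset.sum_congr rfl h2]
    refine Finset.sum_comm' fun τ' ρ => ?_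
    simp only [Finset.mem_erase, Finset.mem_inter, mem_faceFinset, hK.mem_cofaceFinset]
    tauto
  rw [Finset.sum_congr rfl h1, Finset.sum_comm]
  refine Finset.sum_congr rfl fun ρ _ => Finset.sum_comm' fun σ τ' => ?_
  simp only [Finset.mem_erase, Finset.mem_inter, mem_faceFinset, hK.mem_cofaceFinset]
  tauto

namespace Coboundary

variable (δ : K.Coboundary) (hK : K.LocallyFinite)

/-- At a maximum of `|u|` with `u ≥ 0`, the Hodge Laplacian is bounded below by the curvature. -/
theorem curvatureH_mul_le {u : K.Fun} {τ : K.Simplex} (hmax : ∀ τ', |u τ'| ≤ u τ) :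
    min (K.curvatureH τ) 0 * u τ ≤ K.m τ * δ.laplacianLM hK .hodge u τ := by
  classical
  have hu : 0 ≤ u τ := (abs_nonneg _).trans (hmax τ)
  rw [laplacianLM_hodge_apply, Pi.add_apply, mul_add]
  by_cases hface : ∃ ρ₀ : K.Simplex, IsFace ρ₀ τ
  · obtain ⟨ρ₀, h₀⟩ := hface
    refine (mul_le_mul_of_nonneg_right (min_le_left _ _) hu).trans ?_
    rw [m_mul_boundaryLM_toLinearMap, m_mul_toLinearMap_boundaryLM, hK.sum_coface_face_eq h₀,
      hK.curvatureH_eq]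
    have key : -((∑ ρ ∈ faceFinset τ, ∑ τ' ∈ (hK.cofaceFinset ρ).erase τ,
        |K.m τ * K.m τ' / K.m ρ - ∑ σ ∈ hK.cofaceFinset τ ∩ hK.cofaceFinset τ', K.m σ|) * u τ) ≤
        (∑ ρ ∈ faceFinset τ, ∑ τ' ∈ (hK.cofaceFinset ρ).erase τ,
          ∑ σ ∈ hK.cofaceFinset τ ∩ hK.cofaceFinset τ',
            K.m σ * (δ.sign τ σ * δ.sign τ' σ) * u τ') +
        ∑ ρ ∈ faceFinset τ, ∑ τ' ∈ (hK.cofaceFinset ρ).erase τ,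
          K.m τ * K.m τ' / K.m ρ * (δ.sign ρ τ * δ.sign ρ τ') * u τ' := by
      rw [Finset.sum_mul, ← Finset.sum_neg_distrib, ← Finset.sum_add_distrib]
      -- The comparison is termwise: the pair `(ρ, τ')` contributes `(X - Y)` times a sign times `u
      -- τ'`, and `|u τ'| ≤ u τ`.
      refine Finset.sum_le_sum fun ρ hρ => ?_
      rw [Finset.sum_mul, ← Finset.sum_neg_distrib, ← Finset.sum_add_distrib]
      refine Finset.sum_le_sum fun τ' hτ' => ?_
      rw [mem_faceFinset] at hρ
      rw [Finset.mem_erase, hK.mem_cofaceFinset] at hτ'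
      set X := K.m τ * K.m τ' / K.m ρ
      set Y := ∑ σ ∈ hK.cofaceFinset τ ∩ hK.cofaceFinset τ', K.m σ with hY
      have e : ∑ σ ∈ hK.cofaceFinset τ ∩ hK.cofaceFinset τ',
          K.m σ * (δ.sign τ σ * δ.sign τ' σ) * u τ' =
          -(Y * (δ.sign ρ τ * δ.sign ρ τ') * u τ') := by
        rw [hY, Finset.sum_mul, Finset.sum_mul, ← Finset.sum_neg_distrib]
        refine Finset.sum_congr rfl fun σ hσ => ?_
        rw [Finset.mem_inter, hK.mem_cofaceFinset, hK.mem_cofaceFinset] at hσ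
        rw [δ.sign_mul_sign_coface hρ hσ.1 hτ'.2 hσ.2 hτ'.1]
        ring
      have hs : |δ.sign ρ τ * δ.sign ρ τ'| ≤ 1 := by
        rw [abs_mul]
        exact mul_le_one₀ (δ.abs_sign_le _ _) (abs_nonneg _) (δ.abs_sign_le _ _)
      have hb : |(X - Y) * ((δ.sign ρ τ * δ.sign ρ τ') * u τ')| ≤ |X - Y| * u τ := by
        rw [abs_mul]
        refine mul_le_mul_of_nonneg_left ?_ (abs_nonneg _)
        rw [abs_mul]
        exact (mul_le_of_le_one_left (abs_nonneg _) hs).trans (hmax τ')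
      rw [e]
      linarith [(abs_le.1 hb).1]
    linarith
  -- Without a face of `τ`, the negative part of `c^H` is an empty sum and misses the neighbours of
  -- `τ` through cofaces; hence the `min` with `0`. Each coface has at most one other face `τ'`, so
  -- it contributes at least `m σ * (u τ - |u τ'|) ≥ 0`, or `m σ * u τ` if there is none.
  · have hempty : faceFinset τ = ∅ :=
      Finset.eq_empty_of_forall_notMem fun ρ hρ => hface ⟨ρ, mem_faceFinset.1 hρ⟩
    refine (mul_nonpos_of_nonpos_of_nonneg (min_le_right _ _) hu).trans ?_
    have hcard : ∀ σ ∈ hK.cofaceFinset τ, ((faceFinset σ).erase τ).card ≤ 1 := by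
      intro σ hσ
      exact (hK.mem_cofaceFinset.1 hσ).card_erase_faceFinset_le fun ρ hρ => hface ⟨ρ, hρ⟩
    rw [m_mul_boundaryLM_toLinearMap, m_mul_toLinearMap_boundaryLM, hempty, Finset.sum_empty,
      Finset.sum_empty, zero_mul, add_zero, add_zero, Finset.sum_mul, ← Finset.sum_add_distrib]
    refine Finset.sum_nonneg fun σ hσ => ?_
    have hb : |∑ τ' ∈ (faceFinset σ).erase τ, K.m σ * (δ.sign τ σ * δ.sign τ' σ) * u τ'| ≤
        K.m σ * u τ := by
      refine (Finset.abs_sum_le_sum_abs _ _).trans ?_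
      refine (Finset.sum_le_card_nsmul _ _ (K.m σ * u τ) fun τ' _ => ?_).trans ?_
      · rw [abs_mul, abs_mul, abs_mul, abs_of_pos (K.m_pos σ)]
        refine mul_le_mul ?_ (hmax τ') (abs_nonneg _) (K.m_pos σ).le
        exact mul_le_of_le_one_right (K.m_pos σ).le
          (mul_le_one₀ (δ.abs_sign_le _ _) (abs_nonneg _) (δ.abs_sign_le _ _))
      · rw [nsmul_eq_mul]
        refine mul_le_of_le_one_left (mul_nonneg (K.m_pos σ).le hu) ?_
        exact_mod_cast hcard σ hσ
    linarith [(abs_le.1 hb).1]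

end Coboundary

/-! ### Finitely supported functions and maxima in `ℓ²` -/

theorem L2.inner_eq_pairing (f g : K.L2) :
    ⟪f, g⟫_ℝ = pairing (L2.toFun K f) (L2.toFun K g) :=
  L2.inner_eq K f g

theorem L2.exists_of_mem_Fc {ω : K.Fun} (h : ω ∈ K.Fc) : ∃ f : K.L2, L2.toFun K f = ω := by
  refine (L2.exists_iff K ω).2 ?_
  obtain ⟨T, hT⟩ := Fc_iff_exists_finset.1 h
  exact summable_of_ne_finset_zero (s := T) fun τ hτ => by rw [hT τ hτ]; ring

theorem dense_FcL2 (K : WeightedComplex V) : Dense (K.FcL2 : Set K.L2) := by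
  classical
  intro f
  refine mem_closure_of_tendsto (lp.hasSum_single (p := 2) (by norm_num) f)
    (Filter.Eventually.of_forall fun T => ?_)
  refine Submodule.sum_mem _ fun τ _ => ?_
  refine Fc_iff_exists_finset.2 ⟨{τ}, fun σ hσ => ?_⟩
  change (lp.single 2 τ (f τ) σ : K.Fibre σ).val = 0
  rw [lp.single_apply_ne _ _ _ (by simpa using hσ), map_zero]

/-- A square summable function on a complex with uniformly positive weight attains the maximum of
its absolute value. -/
theorem UniformlyPositive.exists_max_abs (hpos : K.UniformlyPositive) {ω : K.Fun}
    (hω : Summable fun σ => K.m σ * ω σ ^ 2) (h0 : ω ≠ 0) :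
    ∃ τ, ω τ ≠ 0 ∧ ∀ τ', |ω τ'| ≤ |ω τ| := by
  obtain ⟨c, hc, hm⟩ := hpos
  obtain ⟨τ₀, hτ₀⟩ := Function.ne_iff.1 h0
  have hτ₀ : 0 < |ω τ₀| := abs_pos.2 hτ₀
  -- On this set the terms `m ω²` are at least `c * |ω τ₀| ^ 2`, which a convergent series allows
  -- only finitely often.
  have hfin : {τ | |ω τ₀| ≤ |ω τ|}.Finite := by
    have h := hω.tendsto_cofinite_zero.eventually
      (gt_mem_nhds (show 0 < c * |ω τ₀| ^ 2 by positivity))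
    rw [Filter.eventually_cofinite] at h
    refine h.subset fun τ hτ => not_lt.2 ?_
    rw [← sq_abs (ω τ)]
    exact mul_le_mul (hm τ) (pow_le_pow_left₀ hτ₀.le hτ 2) (by positivity) (K.m_pos τ).le
  obtain ⟨τ, hτ, hmax⟩ := hfin.exists_maximalFor (fun τ => |ω τ|) _ ⟨τ₀, le_refl (|ω τ₀|)⟩
  refine ⟨τ, abs_pos.1 (hτ₀.trans_le hτ), fun τ' => ?_⟩
  by_contra! hlt
  exact hlt.not_ge (hmax (le_trans hτ hlt.le) hlt.le)

/-! ### The maximum principle and the operators in `ℓ²` -/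

namespace Coboundary

variable (δ : K.Coboundary) (hK : K.LocallyFinite)

/-- If the Forman curvature is bounded below by `C`, then `-c` is not an `ℓ²`-eigenvalue of the
Hodge Laplacian for `c > max (-C) 0`. -/
theorem eq_zero_of_laplacianLM_hodge_eq (hpos : K.UniformlyPositive) {C c : ℝ}
    (hcurv : ∀ τ, C ≤ K.formanCurvature τ) (hc : 0 < c) (hC : -C < c) {ω : K.Fun}
    (hω : Summable fun σ => K.m σ * ω σ ^ 2) (h : δ.laplacianLM hK .hodge ω = (-c) • ω) :
    ω = 0 := by
  by_contra h0
  obtain ⟨τ, hτ, hmax⟩ := hpos.exists_max_abs hω h0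
  have main : ∀ u : K.Fun, 0 < u τ → (∀ τ', |u τ'| ≤ u τ) →
      δ.laplacianLM hK .hodge u = (-c) • u → False := by
    intro u hu humax hu'
    have hle := δ.curvatureH_mul_le hK humax
    rw [hu', Pi.smul_apply, smul_eq_mul] at hle
    have hCτ : C * K.m τ ≤ K.curvatureH τ := (le_div_iff₀ (K.m_pos τ)).1 (hcurv τ)
    -- `-C < c` handles the curvature, `0 < c` the simplices without faces.
    have hmin : -(c * K.m τ) < min (K.curvatureH τ) 0 := by
      refine lt_min ?_ ?_
      · have := mul_lt_mul_of_pos_right hC (K.m_pos τ)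
        linarith
      · have := mul_pos hc (K.m_pos τ)
        linarith
    have := mul_lt_mul_of_pos_right hmin hu
    linarith
  rcases hτ.lt_or_gt with hneg | hpos'
  · refine main (-ω) (by simpa using hneg) (fun τ' => ?_) (by rw [map_neg, h, smul_neg])
    rw [Pi.neg_apply, Pi.neg_apply, abs_neg, ← abs_of_neg hneg]
    exact hmax τ'
  · exact main ω hpos' (fun τ' => (hmax τ').trans_eq (abs_of_pos hpos')) h

theorem mem_partL2_toPMap_graph (A : K.Fun →ₗ[ℝ] K.Fun) (f g : K.L2) :
    (f, g) ∈ (K.partL2 (A.toPMap ⊤)).graph ↔ A (L2.toFun K f) = L2.toFun K g := by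
  rw [partL2_graph, Submodule.mem_comap, LinearPMap.mem_graph_iff]
  constructor
  · rintro ⟨y, hy, hy'⟩
    simp only [LinearMap.prodMap_apply] at hy hy'
    rw [← hy', ← hy]
    rfl
  · intro h
    exact ⟨⟨L2.toFun K f, trivial⟩, rfl, h⟩

theorem FcL2_le_partL2_domain {A : K.Fun →ₗ[ℝ] K.Fun} (hA : ∀ ω ∈ K.Fc, A ω ∈ K.Fc) :
    K.FcL2 ≤ (K.partL2 (A.toPMap ⊤)).domain := by
  intro f hf
  obtain ⟨g, hg⟩ := L2.exists_of_mem_Fc (hA _ hf)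
  exact LinearPMap.mem_domain_of_mem_graph ((mem_partL2_toPMap_graph A f g).2 hg.symm)

include hK in
theorem FcL2_le_neumannOp_domain (k : Kind) : K.FcL2 ≤ (δ.neumannOp k).domain := by
  rw [neumannOp, δ.firstOrder_eq_toPMap hK]
  exact FcL2_le_partL2_domain fun _ => δ.firstOrderLM_mem_Fc hK k

theorem toFun_neumannOp (k : Kind) (x : (δ.neumannOp k).domain) :
    L2.toFun K (δ.neumannOp k x) = δ.firstOrderLM hK k (L2.toFun K x) := by
  have h : ((x : K.L2), δ.neumannOp k x) ∈ (K.partL2 (δ.firstOrder k)).graph :=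
    LinearPMap.mem_graph _ x
  rw [δ.firstOrder_eq_toPMap hK] at h
  exact ((mem_partL2_toPMap_graph _ _ _).1 h).symm

include hK in
theorem laplacianC_domain (k : Kind) : (δ.laplacianC k).domain = K.FcL2 := by
  rw [laplacianC, LinearPMap.domRestrict_domain, δ.formalLaplacian_eq_toPMap hK]
  exact inf_eq_left.2 (FcL2_le_partL2_domain fun _ => δ.laplacianLM_mem_Fc hK k)

theorem toFun_laplacianC (k : Kind) (x : (δ.laplacianC k).domain) :
    L2.toFun K (δ.laplacianC k x) = δ.laplacianLM hK k (L2.toFun K x) := by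
  have h := LinearPMap.le_graph_of_le LinearPMap.domRestrict_le
    (LinearPMap.mem_graph (δ.laplacianC k) x)
  rw [δ.formalLaplacian_eq_toPMap hK] at h
  exact ((mem_partL2_toPMap_graph _ _ _).1 h).symm

theorem inner_laplacianC (k : Kind) (x : (δ.laplacianC k).domain) (u : K.L2) :
    ⟪δ.laplacianC k x, u⟫_ℝ = pairing (L2.toFun K x) (δ.laplacianLM hK k (L2.toFun K u)) := by
  have hx : L2.toFun K x ∈ K.Fc := (δ.laplacianC_domain hK k).le x.2
  rw [L2.inner_eq_pairing, δ.toFun_laplacianC hK, δ.pairing_laplacianLM hK k hx]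

include hK in
theorem laplacianC_isFormalAdjoint (k : Kind) :
    (δ.laplacianC k).IsFormalAdjoint (δ.laplacianC k) := by
  intro x y
  rw [δ.inner_laplacianC hK, ← δ.toFun_laplacianC hK, L2.inner_eq_pairing]

include hK in
/-- Green's formula for finitely supported functions. -/
theorem inner_laplacianC_eq_inner_neumannOp (k : Kind) (x : (δ.laplacianC k).domain)
    (y z : (δ.neumannOp k).domain) (hxy : (y : K.L2) = x) :
    ⟪δ.laplacianC k x, (z : K.L2)⟫_ℝ = ⟪δ.neumannOp k y, δ.neumannOp k z⟫_ℝ := by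
  have hx : L2.toFun K x ∈ K.Fc := (δ.laplacianC_domain hK k).le x.2
  rw [L2.inner_eq_pairing, L2.inner_eq_pairing, δ.toFun_laplacianC hK, δ.toFun_neumannOp hK,
    δ.toFun_neumannOp hK, hxy]
  exact δ.pairing_adjointLM hK k (δ.firstOrderLM_mem_Fc hK k hx) _

include hK in
theorem laplacianC_nonneg (k : Kind) (x : (δ.laplacianC k).domain) :
    0 ≤ ⟪δ.laplacianC k x, (x : K.L2)⟫_ℝ := by
  have hx : (x : K.L2) ∈ K.FcL2 := (δ.laplacianC_domain hK k).le x.2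
  have h := δ.inner_laplacianC_eq_inner_neumannOp hK k x
    ⟨x, δ.FcL2_le_neumannOp_domain hK k hx⟩ ⟨x, δ.FcL2_le_neumannOp_domain hK k hx⟩ rfl
  rw [h]
  exact real_inner_self_nonneg

include hK in
-- By the form identity for `A` and Green's formula, `Δ_c` is a formal adjoint of `A`, so it lies
-- below `A* = A`. Self-adjointness thus supplies `F^c ⊆ D(A)`.
theorem IsLaplacian.domRestrict_FcL2 {k : Kind} {A : K.L2 →ₗ.[ℝ] K.L2}
    (hA : δ.IsLaplacian k A) : A.domRestrict K.FcL2 = δ.laplacianC k := by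
  obtain ⟨T, hDT, hTN, -, hself, -, hAT, hform⟩ := hA
  have hFT : K.FcL2 ≤ T.domain := by
    refine le_trans ?_ hDT.1
    refine le_trans ?_ (LinearPMap.le_closure _).1
    exact le_inf le_rfl (δ.FcL2_le_neumannOp_domain hK k)
  have hle : δ.laplacianC k ≤ A := by
    rw [← LinearPMap.isSelfAdjoint_def.1 hself]
    refine LinearPMap.IsFormalAdjoint.le_adjoint hself.dense_domain fun η x => ?_
    have hx : (x : K.L2) ∈ K.FcL2 := (δ.laplacianC_domain hK k).le x.2
    have h := hform ⟨x, hFT hx⟩ η ⟨η, hAT η.2⟩ rfl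
    rw [real_inner_comm, ← h, real_inner_comm (δ.laplacianC k x),
      δ.inner_laplacianC_eq_inner_neumannOp hK k x ⟨x, hTN.1 (hFT hx)⟩ ⟨η, hTN.1 (hAT η.2)⟩ rfl]
    congr 1
    · exact hTN.2 rfl
    · exact hTN.2 rfl
  refine LinearPMap.ext ?_ fun x hx hx' => ?_
  · rw [LinearPMap.domRestrict_domain, δ.laplacianC_domain hK k]
    exact inf_eq_left.2 ((δ.laplacianC_domain hK k).ge.trans hle.1)
  · exact (LinearPMap.domRestrict_apply (y := ⟨x, hle.1 hx'⟩) rfl).trans (hle.2 rfl).symm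

theorem isEssentiallySelfAdjoint_laplacianC (hsum : K.LocallySummable)
    (hpos : K.UniformlyPositive) (hcurv : ∃ C : ℝ, ∀ τ : K.Simplex, C ≤ K.formanCurvature τ)
    (k : Kind) : IsEssentiallySelfAdjoint (δ.laplacianC k) := by
  have hK := hsum.locallyFinite hpos
  obtain ⟨C, hC⟩ := hcurv
  -- The shift `|C| + 1` exceeds both `0` and `-C`.
  have hc : 0 < |C| + 1 := by positivity
  refine isEssentiallySelfAdjoint_of_range_dense ?_ (δ.laplacianC_isFormalAdjoint hK k)
    (δ.laplacianC_nonneg hK k) hc fun u hu => ?_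
  · rw [δ.laplacianC_domain hK k]
    exact K.dense_FcL2
  -- Orthogonality tested on `1_τ` gives the eigenvalue equation at `τ`.
  have heq : δ.laplacianLM hK k (L2.toFun K u) = (-(|C| + 1)) • L2.toFun K u := by
    funext τ
    obtain ⟨f, hf⟩ := L2.exists_of_mem_Fc (char_mem_Fc τ)
    have hfF : f ∈ (δ.laplacianC k).domain := by
      rw [δ.laplacianC_domain hK k]
      change L2.toFun K f ∈ K.Fc
      rw [hf]
      exact char_mem_Fc τ
    have h := hu ⟨f, hfF⟩
    rw [inner_add_left, real_inner_smul_left, δ.inner_laplacianC hK, L2.inner_eq_pairing] at h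
    simp only [hf, pairing_char] at h
    have h' : K.m τ * (δ.laplacianLM hK k (L2.toFun K u) τ + (|C| + 1) * L2.toFun K u τ) = 0 := by
      linarith
    have := (mul_eq_zero.1 h').resolve_left (K.m_pos τ).ne'
    rw [Pi.smul_apply, smul_eq_mul]
    linarith
  have h0 := δ.eq_zero_of_laplacianLM_hodge_eq hK hpos hC hc (by linarith [neg_le_abs C])
    ((L2.exists_iff K _).1 ⟨u, rfl⟩)
    (δ.laplacianLM_hodge_of_eigen hK k (neg_ne_zero.2 hc.ne') heq)
  exact L2.toFun_injective K (h0.trans (map_zero _).symm)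

end Coboundary

end WeightedComplex

end

theorem mainTheorem1 {V : Type*} [Countable V] (K : WeightedComplex V) (δ : K.Coboundary)
    (hsum : K.LocallySummable) (hpos : K.UniformlyPositive)
    (hcurv : ∃ C : ℝ, ∀ τ : K.Simplex, C ≤ K.formanCurvature τ) (k : WeightedComplex.Kind) :
    (δ.laplacianC k).domain = K.FcL2 ∧
    (∀ A : K.L2 →ₗ.[ℝ] K.L2, δ.IsLaplacian k A → A.domRestrict K.FcL2 = δ.laplacianC k) ∧
    IsEssentiallySelfAdjoint (δ.laplacianC k) :=
  ⟨δ.laplacianC_domain (hsum.locallyFinite hpos) k,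
    fun _ hA => hA.domRestrict_FcL2 δ (hsum.locallyFinite hpos),
    δ.isEssentiallySelfAdjoint_laplacianC hsum hpos hcurv k⟩
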